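/- **Setting.** A statistical query on $\{0,1\}^d$ is a predicate $q:\{0,1\}^d\to\{0,1\}$; its value on a distribution $\mathcal D$ over $\{0,1\}^d$ is $q(\mathcal D)=\mathbb E_{x\sim\mathcal D}[q(x)]$. An oracle $\mathcal O$ is a (possibly stateful and randomized) algorithm, with no restriction on its running time, that, for any $n,d\in\mathbb N$, holds a tuple $x=(x_1,\dots,x_n)$ of samples in $\{0,1\}^d$ and returns an answer in $[0,1]$ to each query on $\{0,1\}^d$ that is put to it. *Accuracy.* Consider the following game between $\mathcal O$ and a (possibly randomized and stateful) adversary $\mathcal A$: $\mathcal A$ chooses a distribution $\mathcal D$ over $\{0,1\}^d$; $x=(x_1,\dots,x_n)$ is drawn i.i.d. from $\mathcal D$ and given to $\mathcal O$ only; then for $j=1,\dots,k$ the adversary chooses a query $q_j$, depending on $q_1,a_1,\dots,q_{j-1},a_{j-1}$, and $\mathcal O$ returns an answer $a_j$. The oracle is $(\alpha,\beta)$-accurate for $k$ adaptively chosen queries given $n$ samples in $\{0,1\}^d$ if for every adversary $$\Pr\big[\,\forall j\le k:\ |a_j-q_j(\mathcal D)|\le\alpha\,\big]\ \ge\ 1-\beta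 .$$ For a function $k=k(n)$, it is $\alpha$-accurate for $k$ adaptively chosen queries given $n$ samples if there is a function $\beta(n)\to 0$ as $n\to\infty$ such that for all $n,d\in\mathbb N$ it is $(\alpha,\beta(n))$-accurate for $k(n)$ adaptively chosen queries given $n$ samples in $\{0,1\}^d$. *Naturalness.* The oracle is natural if for every sample $x=(x_1,\dots,x_n)$ that it may hold, in each of its possible states, any two queries $q,q'$ with $q(x_i)=q'(x_i)$ for all $i$ receive identically distributed answers (hence identical answers if the oracle is deterministic). **Theorem.** There is a function $k:\mathbb N\to\mathbb N$ with $k(n)=n^{3+o(1)}$ such that no natural oracle is $(1/2000)$-accurate for $k(n)$ adaptively chosen queries given $n$ samples. -/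

import Mathlib

open MeasureTheory ProbabilityTheory Filter Topology

universe u

namespace AdaptiveSQ

/-- A data point: an element of `{0,1}^d`. -/
abbrev Point (d : ℕ) : Type := Fin d → Bool

/-- A statistical query on `{0,1}^d`, given by its predicate `{0,1}^d → {0,1}`. -/
abbrev Query (d : ℕ) : Type := Point d → Bool

/-- The value `q(D) = E_{x ∼ D} q(x)` of a statistical query on a distribution `D`. -/
noncomputable def Query.value {d : ℕ} (q : Query d) (D : PMF (Point d)) : ℝ :=
  ∑ y : Point d, (D y).toReal * (if q y = true then 1 else 0)

/-- A stateful randomized query-answering mechanism with answers in `[0,1]`. It starts in a random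
state; a query asked in a state yields, at random and jointly, an answer and a new state, which may
depend in any way on the old state, on the query and on the answer. No bound is put on the state
space or on the running time. -/
structure Mechanism (d : ℕ) : Type (u + 1) where
  State : Type u
  [measurableState : MeasurableSpace State]
  init : Measure State
  [isProbabilityMeasure_init : IsProbabilityMeasure init]
  step : Query d → Kernel State (unitInterval × State)
  [isMarkovKernel_step : ∀ q, IsMarkovKernel (step q)]

attribute [instance] Mechanism.measurableState Mechanism.isProbabilityMeasure_init
  Mechanism.isMarkovKernel_step

/-- An oracle: for all `n` and `d`, a mechanism for each tuple of `n` samples in `{0,1}^d` that the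
oracle may hold. -/
structure Oracle : Type (u + 1) where
  hold : ∀ {n d : ℕ}, (Fin n → Point d) → Mechanism.{u} d

/-- An oracle is natural if, whatever sample it holds and in whichever of its states, two queries
that agree on the sample points receive identically distributed answers. -/
def Oracle.IsNatural (O : Oracle.{u}) : Prop :=
  ∀ (n d : ℕ) (x : Fin n → Point d) (q q' : Query d), (∀ i, q (x i) = q' (x i)) →
    ∀ s : (O.hold x).State,
      ((O.hold x).step q s).map Prod.fst = ((O.hold x).step q' s).map Prod.fst

/-- The first `j` queries of a play together with the answers to them. -/
abbrev History (d j : ℕ) : Type := Fin j → Query d × unitInterval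

/-- An adaptive adversary. Its randomness is a random tape `ω ∼ law`, drawn at the start of the
game and never shown to the oracle. The tape determines the distribution which the adversary
chooses; the tape and the previous queries and answers determine the next query. (The memory of
the adversary is a function of the tape and the history.) -/
structure Adversary (d : ℕ) where
  Tape : Type
  [measurableTape : MeasurableSpace Tape]
  law : Measure Tape
  [isProbabilityMeasure_law : IsProbabilityMeasure law]
  dist : Tape → PMF (Point d)
  measurable_dist : ∀ y, Measurable fun ω => dist ω y
  query : ∀ j : ℕ, Tape → History d j → Query d
  measurable_query : ∀ j, Measurable fun p : Tape × History d j => query j p.1 p.2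

attribute [instance] Adversary.measurableTape Adversary.isProbabilityMeasure_law

/-- One round of the interaction, as a map from the history and the state before round `j` to the
law of the history and the state after it: the query prescribed by the strategy is put to the
mechanism. -/
noncomputable def round {d : ℕ} (M : Mechanism.{u} d) (strategy : ∀ j, History d j → Query d)
    (j : ℕ) (c : History d j × M.State) : Measure (History d (j + 1) × M.State) :=
  (M.step (strategy j c.1) c.2).map fun r =>
    (Fin.snoc (α := fun _ => Query d × unitInterval) c.1 (strategy j c.1, r.1), r.2)

/-- The joint law of the history of the first `j` rounds and of the state of the mechanism after
them. -/
noncomputable def play {d : ℕ} (M : Mechanism.{u} d) (strategy : ∀ j, History d j → Query d) :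
    (j : ℕ) → Measure (History d j × M.State)
  | 0 => M.init.map fun s => (Fin.elim0, s)
  | j + 1 => (play M strategy j).bind (round M strategy j)

/-- The rounds depend measurably on the past, so that the composition of measures in `play` is a
genuine one. -/
theorem measurable_round {d : ℕ} (M : Mechanism.{u} d) (st : ∀ j, History d j → Query d)
    (hst : ∀ j, Measurable (st j)) (j : ℕ) : Measurable (round M st j) := by
  have key : ∀ q : Query d, Measurable fun c : History d j × M.State =>
      (M.step q c.2).map fun r : unitInterval × M.State =>
        ((Fin.snoc (α := fun _ => Query d × unitInterval) c.1 (q, r.1) : History d (j+1)), r.2) := by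
    intro q
    let κ : Kernel (History d j × M.State) (unitInterval × M.State) :=
      (M.step q).comap Prod.snd measurable_snd
    have hm : Measurable fun p : (History d j × M.State) × (unitInterval × M.State) =>
        ((Fin.snoc (α := fun _ => Query d × unitInterval) p.1.1 (q, p.2.1) : History d (j+1)), p.2.2) := by
      refine Measurable.prodMk ?_ (by fun_prop)
      refine measurable_pi_lambda _ fun i => ?_
      refine Fin.lastCases ?_ (fun i => ?_) i
      · simp only [Fin.snoc_last]; fun_prop
      · simp only [Fin.snoc_castSucc]; fun_prop
    have := ((Kernel.id ×ₖ κ).map (fun p : (History d j × M.State) × (unitInterval × M.State) =>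
        ((Fin.snoc (α := fun _ => Query d × unitInterval) p.1.1 (q, p.2.1) : History d (j+1)), p.2.2))).measurable
    convert this using 2 with c
    rw [Kernel.map_apply _ hm, Kernel.prod_apply, Kernel.id_apply, Measure.dirac_prod,
      Measure.map_map hm (by fun_prop)]
    rfl
  have : round M st j = fun c => (fun q : Query d => (M.step q c.2).map fun r : unitInterval × M.State =>
        ((Fin.snoc (α := fun _ => Query d × unitInterval) c.1 (q, r.1) : History d (j+1)), r.2)) (st j c.1) := rfl
  rw [this]
  have h2 : Measurable (fun p : Query d × (History d j × M.State) => (M.step p.1 p.2.2).map fun r : unitInterval × M.State =>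
        ((Fin.snoc (α := fun _ => Query d × unitInterval) p.2.1 (p.1, r.1) : History d (j+1)), r.2)) :=
    measurable_from_prod_countable_right key
  exact h2.comp (((hst j).comp measurable_fst).prodMk measurable_id)

/-- `play` is a probability law. -/
theorem isProbabilityMeasure_play {d : ℕ} (M : Mechanism.{u} d) (st : ∀ j, History d j → Query d)
    (hst : ∀ j, Measurable (st j)) (j : ℕ) : IsProbabilityMeasure (play M st j) := by
  induction j with
  | zero => exact Measure.isProbabilityMeasure_map (by fun_prop)
  | succ j ih =>
    rw [play]
    refine isProbabilityMeasure_bind (measurable_round M st hst j).aemeasurable ?_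
    refine Filter.Eventually.of_forall fun c => ?_
    refine Measure.isProbabilityMeasure_map (Measurable.aemeasurable ?_)
    refine Measurable.prodMk ?_ (by fun_prop)
    refine measurable_pi_lambda _ fun i => ?_
    refine Fin.lastCases ?_ (fun i => ?_) i
    · simp only [Fin.snoc_last]; fun_prop
    · simp only [Fin.snoc_castSucc]; fun_prop

/-- In a game with `n` samples and `k` queries: the probability that all `k` answers are within `α`
of the values of the queries on the distribution that the adversary has chosen. The adversary draws
its tape `ω` and thereby chooses `D`; the sample `x` consists of `n` independent draws from `D`;
then the adversary and the oracle holding `x` interact for `k` rounds. -/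
noncomputable def accuracyProb (O : Oracle.{u}) {d : ℕ} (A : Adversary d) (n k : ℕ) (α : ℝ) :
    ENNReal :=
  ∫⁻ ω, ∫⁻ x : Fin n → Point d,
      play (O.hold x) (fun j => A.query j ω) k
        {c | ∀ j : Fin k, |((c.1 j).2 : ℝ) - (c.1 j).1.value (A.dist ω)| ≤ α}
    ∂(Measure.pi fun _ => (A.dist ω).toMeasure) ∂A.law

/-- `(α, β)`-accuracy for `k` adaptively chosen queries given `n` samples in `{0,1}^d`. -/
def Oracle.IsAccurateGiven (O : Oracle.{u}) (α β : ℝ) (k n d : ℕ) : Prop :=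
  ∀ A : Adversary d, ENNReal.ofReal (1 - β) ≤ accuracyProb O A n k α

/-- `α`-accuracy for `k = k(n, d)` adaptively chosen queries: for all `n` and `d`, the oracle is
`(α, o_n(1))`-accurate for `k(n, d)` queries given `n` samples in `{0,1}^d`, where `o_n(1)` is a
function of `n` alone that tends to `0`. -/
def Oracle.IsAccurate (O : Oracle.{u}) (α : ℝ) (k : ℕ → ℕ → ℕ) : Prop :=
  ∃ β : ℕ → ℝ, Tendsto β atTop (𝓝 0) ∧ ∀ n d, O.IsAccurateGiven α (β n) (k n d) n d

/-- `k(n) = n^{a + o(1)}` as `n → ∞`. -/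
def IsPowerUpToLittleO (k : ℕ → ℕ) (a : ℝ) : Prop :=
  ∃ ε : ℕ → ℝ, Tendsto ε atTop (𝓝 0) ∧ ∀ᶠ n : ℕ in atTop, (k n : ℝ) = (n : ℝ) ^ (a + ε n)

end AdaptiveSQ

namespace AdaptiveSQ

/-! The attack is interactive fingerprinting on the uniform distribution over the cube, of size N.
Each round draws a mean p uniformly (from a fine finite grid, `exists_grid`) and gives every point
an independent bit of mean p. For any answer function g with values in [0,1], integrating the
derivative of p(1-p)E[g] over [0,1] yields E[g Σ(q(y)-p)] = E[g(2p-1)]. If g is close to p, the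
right side is close to ∫p(2p-1) = 1/6, so accurate answers must correlate with the bits. By
naturalness they can do so only with bits of sample points (`fingerprinting_le`).

The score of a point accumulates a(q(y)-p), and a point is masked once its score exceeds σ. This
caps the total score of the sample at n(σ+1) (`score_le`), whereas k accurate rounds would raise it
to about k/6. Outside the sample the scores are martingales with increments at most 1, so for σ²
much larger than k few points are masked and the true value stays near p. It suffices that √k ≪ σ ≪
k/n; here k = n³ and σ = n²/100.

No conditioning on accuracy is needed, because `potential` is a submartingale in every case
(`potential_le_average`): an inaccurate round is paid for by the count of inaccuracies, and the
masked points by the squared scores, whose weight lam(k-j) falls by lam per round. As `potential`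
starts at 0, its mean at the end bounds the probability of accuracy for each fixed sample
(`average_accurate_le`). Accuracy against each fixed tape, averaged over tapes, contradicts this
bound. -/

/-! ### Riemann sums -/

/-- Riemann sums of the derivative of a polynomial over the grid of mesh `1 / m`. -/
theorem tendsto_riemannSum_derivative (Q : Polynomial ℝ) :
    Tendsto (fun m : ℕ => (1 / (m : ℝ)) * ∑ l : Fin m, Q.derivative.eval ((l : ℝ) / m))
      atTop (𝓝 (Q.eval 1 - Q.eval 0)) := by
  rw [Metric.tendsto_atTop]
  intro ε hε
  have huc : UniformContinuousOn (fun x => Q.derivative.eval x) (Set.Icc (0 : ℝ) 1) :=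
    isCompact_Icc.uniformContinuousOn_of_continuous Q.derivative.continuous.continuousOn
  obtain ⟨η, hη, hη'⟩ := Metric.uniformContinuousOn_iff.1 huc (ε / 2) (half_pos hε)
  obtain ⟨M, hM⟩ := exists_nat_gt (1 / η)
  refine ⟨M + 1, fun m hm => ?_⟩
  have hm0 : (0 : ℝ) < m := by exact_mod_cast (by omega : 0 < m)
  have hmη : 1 / (m : ℝ) < η := by
    rw [div_lt_comm₀ hm0 hη]
    exact hM.trans (by exact_mod_cast hm)
  have hterm : ∀ l : ℕ, l < m →
      |1 / (m : ℝ) * Q.derivative.eval ((l : ℝ) / m) -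
        (Q.eval (((l + 1 : ℕ) : ℝ) / m) - Q.eval ((l : ℝ) / m))| ≤ 1 / m * (ε / 2) := by
    intro l hl
    have hlt : (l : ℝ) / m < ((l + 1 : ℕ) : ℝ) / m := by
      push_cast; gcongr; linarith
    -- The increment over a cell is the derivative at some ξ of the cell, which uniform continuity
    -- compares with the left endpoint; the increments then telescope.
    obtain ⟨ξ, hξ, hξ'⟩ := exists_deriv_eq_slope (fun x => Q.eval x) hlt
      Q.continuous.continuousOn Q.differentiable.differentiableOn
    have hw : ((l + 1 : ℕ) : ℝ) / m - (l : ℝ) / m = 1 / m := by push_cast; ring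
    have h1 : ((l + 1 : ℕ) : ℝ) / m ≤ 1 := by
      rw [div_le_one hm0]; exact_mod_cast hl
    have h0 : 0 ≤ (l : ℝ) / m := by positivity
    rw [Polynomial.deriv, hw, eq_div_iff (by positivity)] at hξ'
    rw [← hξ', mul_comm (Polynomial.eval ξ _), ← mul_sub, abs_mul, abs_of_pos (by positivity)]
    refine mul_le_mul_of_nonneg_left ?_ (by positivity)
    have := hη' ((l : ℝ) / m) ⟨h0, hlt.le.trans h1⟩ ξ ⟨h0.trans hξ.1.le, hξ.2.le.trans h1⟩ (by
      rw [dist_comm, Real.dist_eq, abs_of_pos (by linarith [hξ.1])]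
      linarith [hξ.2])
    exact (Real.dist_eq _ _ ▸ this).le
  have htel : Q.eval 1 - Q.eval 0 = ∑ l ∈ Finset.range m,
      (Q.eval (((l + 1 : ℕ) : ℝ) / m) - Q.eval ((l : ℝ) / m)) := by
    rw [Finset.sum_range_sub (fun l : ℕ => Q.eval ((l : ℝ) / m)), div_self hm0.ne']
    simp
  rw [Fin.sum_univ_eq_sum_range (fun l : ℕ => Q.derivative.eval ((l : ℝ) / m)), htel,
    Real.dist_eq, Finset.mul_sum, ← Finset.sum_sub_distrib]
  calc _ ≤ ∑ l ∈ Finset.range m, 1 / (m : ℝ) * (ε / 2) :=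
        (Finset.abs_sum_le_sum_abs _ _).trans
          (Finset.sum_le_sum fun l hl => hterm l (Finset.mem_range.1 hl))
    _ = ε / 2 := by
        rw [Finset.sum_const, Finset.card_range, nsmul_eq_mul]; field_simp
    _ < ε := half_lt_self hε

/-! ### Independent bits with a random mean -/

/-- The value of a bit as a real number. -/
def bit (b : Bool) : ℝ := if b = true then 1 else 0

theorem bit_nonneg (b : Bool) : 0 ≤ bit b := by cases b <;> simp [bit]

theorem bit_le_one (b : Bool) : bit b ≤ 1 := by cases b <;> simp [bit]

/-- The probability of the bit string `q` when the bits are independent with mean `p`. -/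
def bernoulliWeight {ι : Type*} [Fintype ι] (p : ℝ) (q : ι → Bool) : ℝ :=
  ∏ y, if q y = true then p else 1 - p

section Bernoulli

variable {ι : Type*} [Fintype ι]

theorem bernoulliWeight_nonneg {p : ℝ} (h0 : 0 ≤ p) (h1 : p ≤ 1) (q : ι → Bool) :
    0 ≤ bernoulliWeight p q :=
  Finset.prod_nonneg fun y _ => by split_ifs <;> linarith

theorem sum_bernoulliWeight [DecidableEq ι] (p : ℝ) :
    ∑ q : ι → Bool, bernoulliWeight p q = 1 := by
  have := (Fintype.prod_sum (fun (_ : ι) (b : Bool) => if b = true then p else 1 - p)).symm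
  simpa [bernoulliWeight] using this

/-- A bit is uncorrelated with every function of the other bits. -/
theorem sum_bernoulliWeight_mul_sub [DecidableEq ι] (p : ℝ) (y : ι) (g : (ι → Bool) → ℝ)
    (hg : ∀ q, g (Function.update q y (!q y)) = g q) :
    ∑ q : ι → Bool, bernoulliWeight p q * (g q * (bit (q y) - p)) = 0 := by
  -- Flipping the bit at `y` pairs terms that cancel: the factors p(1-p) and (1-p)(-p) are opposite
  -- and the rest is unchanged.
  refine Finset.sum_involution (fun q _ => Function.update q y (!q y)) ?_ ?_ ?_ ?_
  · intro q _
    have hsplit : ∀ q' : ι → Bool, bernoulliWeight p q' =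
        (if q' y = true then p else 1 - p) *
          ∏ z ∈ Finset.univ.erase y, if q' z = true then p else 1 - p :=
      fun q' => (Finset.mul_prod_erase _ _ (Finset.mem_univ y)).symm
    have hrest : (∏ z ∈ Finset.univ.erase y,
        if Function.update q y (!q y) z = true then p else 1 - p) =
          ∏ z ∈ Finset.univ.erase y, if q z = true then p else 1 - p :=
      Finset.prod_congr rfl fun z hz => by
        rw [Function.update_of_ne (Finset.ne_of_mem_erase hz)]
    rw [hg, hsplit, hsplit (Function.update q y (!q y)), hrest, Function.update_self]
    cases q y <;> simp [bit] <;> ring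
  · intro q _ _ h
    have := congrFun h y
    simp at this
  · intro q _; exact Finset.mem_univ _
  · intro q _
    funext z
    by_cases hz : z = y
    · subst hz; simp
    · simp [hz]

theorem sum_bernoulliWeight_mul_bit [DecidableEq ι] (p : ℝ) (y : ι) :
    ∑ q : ι → Bool, bernoulliWeight p q * bit (q y) = p := by
  have h := sum_bernoulliWeight_mul_sub p y (fun _ => 1) fun _ => rfl
  simp only [one_mul, mul_sub, Finset.sum_sub_distrib, ← Finset.sum_mul,
    sum_bernoulliWeight] at h
  linarith

/-- The polynomial `p ↦ p (1 - p) bernoulliWeight p q`, whose derivative is the score of `q`. -/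
theorem exists_polynomial_bernoulliWeight (q : ι → Bool) :
    ∃ Q : Polynomial ℝ, Q.eval 0 = 0 ∧ Q.eval 1 = 0 ∧ ∀ p, Q.derivative.eval p =
      bernoulliWeight p q * (∑ y, (bit (q y) - p) + (1 - 2 * p)) := by
  classical
  set s := (Finset.univ.filter fun y => q y = true).card with hs
  set t := (Finset.univ.filter fun y => ¬ q y = true).card with ht
  -- The extra factor p(1-p) clears the denominator of the logarithmic derivative and makes both
  -- boundary values vanish.
  refine ⟨Polynomial.X ^ (s + 1) * (1 - Polynomial.X) ^ (t + 1), by simp, by simp, fun p => ?_⟩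
  have hw : bernoulliWeight p q = p ^ s * (1 - p) ^ t := by
    rw [bernoulliWeight, Finset.prod_ite, Finset.prod_const, Finset.prod_const]
  have hsum : ∑ y, (bit (q y) - p) = s * (1 - p) - t * p := by
    have : ∀ y, bit (q y) - p = if q y = true then 1 - p else - p := fun y => by
      cases q y <;> simp [bit]
    simp_rw [this]
    rw [Finset.sum_ite, Finset.sum_const, Finset.sum_const, ← hs, ← ht]
    simp; ring
  rw [hw, hsum]
  simp [Polynomial.derivative_mul, Polynomial.derivative_pow]
  ring

/-- For a fine enough grid, the averages over the grid behave as integrals over `[0,1]`. -/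
theorem exists_grid [DecidableEq ι] {δ : ℝ} (hδ : 0 < δ) : ∃ m : ℕ, 0 < m ∧
    (∀ g : (ι → Bool) → ℝ, (∀ q, 0 ≤ g q) → (∀ q, g q ≤ 1) →
      -δ ≤ (1 / (m : ℝ)) * ∑ l : Fin m, ∑ q, bernoulliWeight ((l : ℝ) / m) q *
        (g q * (∑ y, (bit (q y) - (l : ℝ) / m) + (1 - 2 * ((l : ℝ) / m))))) ∧
    1 / 6 - δ ≤ (1 / (m : ℝ)) * ∑ l : Fin m, ((l : ℝ) / m) * (2 * ((l : ℝ) / m) - 1) := by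
  choose Q hQ0 hQ1 hQ using exists_polynomial_bernoulliWeight (ι := ι)
  set K : ℝ := ((Fintype.card (ι → Bool) : ℕ) : ℝ) with hK
  have hKpos : 0 < K := by rw [hK]; exact_mod_cast Fintype.card_pos
  -- Tolerance δ/K for each of the K strings adds up to δ, uniformly in `g`.
  have h1 : ∀ᶠ m : ℕ in atTop, ∀ q, |(1 / (m : ℝ)) * ∑ l : Fin m,
      (Q q).derivative.eval ((l : ℝ) / m)| < δ / K := by
    rw [eventually_all]
    intro q
    have := tendsto_riemannSum_derivative (Q q)
    rw [hQ0, hQ1, sub_zero] at this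
    have := (Metric.tendsto_nhds.1 this) (δ / K) (by positivity)
    simpa [Real.dist_eq] using this
  have h2 : ∀ᶠ m : ℕ in atTop, 1 / 6 - δ ≤
      (1 / (m : ℝ)) * ∑ l : Fin m, ((l : ℝ) / m) * (2 * ((l : ℝ) / m) - 1) := by
    have := tendsto_riemannSum_derivative
      (Polynomial.C (2 / 3) * Polynomial.X ^ 3 - Polynomial.C (1 / 2) * Polynomial.X ^ 2)
    rw [show _ - _ = (1 / 6 : ℝ) by norm_num] at this
    have h := this.eventually (lt_mem_nhds (by linarith : 1 / 6 - δ < 1 / 6))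
    filter_upwards [h] with m hm
    refine hm.le.trans (le_of_eq ?_)
    congr 1
    refine Finset.sum_congr rfl fun l _ => ?_
    simp [Polynomial.derivative_mul, Polynomial.derivative_pow]
    ring
  obtain ⟨m, ⟨h1, h2⟩, hm⟩ := ((h1.and h2).and (eventually_gt_atTop 0)).exists
  refine ⟨m, hm, fun g hg0 hg1 => ?_, h2⟩
  have hswap : (1 / (m : ℝ)) * ∑ l : Fin m, ∑ q, bernoulliWeight ((l : ℝ) / m) q *
        (g q * (∑ y, (bit (q y) - (l : ℝ) / m) + (1 - 2 * ((l : ℝ) / m)))) =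
      ∑ q, g q * ((1 / (m : ℝ)) * ∑ l : Fin m, (Q q).derivative.eval ((l : ℝ) / m)) := by
    simp only [Finset.mul_sum]
    rw [Finset.sum_comm]
    refine Finset.sum_congr rfl fun q _ => Finset.sum_congr rfl fun l _ => ?_
    rw [hQ, Finset.sum_sub_distrib]
    ring
  rw [hswap]
  have : ∑ _q : ι → Bool, -(δ / K) = -δ := by
    rw [Finset.sum_const, nsmul_eq_mul, Finset.card_univ, ← hK]; field_simp
  rw [← this]
  refine Finset.sum_le_sum fun q _ => ?_
  have := (abs_lt.1 (h1 q)).1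
  have hd : 0 < δ / K := by positivity
  nlinarith [hg0 q, hg1 q]

end Bernoulli

/-! ### Integration over one round of play -/

section Play

variable {d : ℕ}

/-- The history after one more round. -/
abbrev History.snoc {j : ℕ} (h : History d j) (q : Query d) (a : unitInterval) :
    History d (j + 1) :=
  Fin.snoc (α := fun _ => Query d × unitInterval) h (q, a)

theorem measurable_history_snoc {j : ℕ} (h : History d j) (q : Query d) :
    Measurable (History.snoc h q) := by
  refine measurable_pi_lambda _ fun i => ?_
  refine Fin.lastCases ?_ (fun i => ?_) i
  · simp only [Fin.snoc_last]; fun_prop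
  · simp only [Fin.snoc_castSucc]; fun_prop

/-- The law of the history depends only on the queries put so far. -/
theorem play_congr (M : Mechanism.{u} d) {st st' : ∀ j, History d j → Query d} {j : ℕ}
    (h : ∀ i < j, st i = st' i) : play M st j = play M st' j := by
  induction j with
  | zero => rfl
  | succ j ih =>
    rw [play, play, ih fun i hi => h i (hi.trans j.lt_succ_self)]
    congr 1
    funext c
    rw [round, round, h j j.lt_succ_self]

variable (M : Mechanism.{u} d) {st : ∀ j, History d j → Query d} (hst : ∀ j, Measurable (st j))
  {j : ℕ}

include hst

theorem integrable_play {f : History d j → ℝ} (hf : Measurable f) {C : ℝ}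
    (hC : ∀ h, |f h| ≤ C) : Integrable (fun c : History d j × M.State => f c.1)
      (play M st j) := by
  have := isProbabilityMeasure_play M st hst j
  exact Integrable.of_bound (hf.comp measurable_fst).aestronglyMeasurable C
    (Eventually.of_forall fun c => hC c.1)

/-- The tower property for the last round, obtained by viewing that round as a kernel composed with
the law of the earlier ones. -/
theorem integral_play_succ {f : History d (j + 1) → ℝ} (hf : Measurable f) {C : ℝ}
    (hC : ∀ h, |f h| ≤ C) :
    Integrable (fun c : History d j × M.State => ∫ r, f (History.snoc c.1 (st j c.1) r.1)
        ∂(M.step (st j c.1) c.2)) (play M st j) ∧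
      ∫ c, f c.1 ∂(play M st (j + 1)) = ∫ c, ∫ r, f (History.snoc c.1 (st j c.1) r.1)
        ∂(M.step (st j c.1) c.2) ∂(play M st j) := by
  let κ : Kernel (History d j × M.State) (History d (j + 1) × M.State) :=
    ⟨round M st j, measurable_round M st hst j⟩
  have hplay : play M st (j + 1) = (κ ∘ₖ Kernel.const Unit (play M st j)) () := by
    rw [Kernel.comp_apply, Kernel.const_apply]; rfl
  have hint := integrable_play M hst hf hC
  rw [hplay] at hint
  have hround : ∀ c, ∫ c', f c'.1 ∂(κ c) =
      ∫ r, f (History.snoc c.1 (st j c.1) r.1) ∂(M.step (st j c.1) c.2) := by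
    intro c
    refine integral_map (Measurable.aemeasurable ?_)
      (hf.comp measurable_fst).aestronglyMeasurable
    exact ((measurable_history_snoc c.1 (st j c.1)).comp measurable_fst).prodMk measurable_snd
  refine ⟨?_, ?_⟩
  · have := hint.integral_comp
    simp only [hround, Kernel.const_apply] at this
    exact this
  · rw [hplay, Kernel.integral_comp hint]
    simp only [hround, Kernel.const_apply]

end Play

/-! ### Averages over the random tape -/

/-- The average of `F` over the first `j` entries of a tape, which are independent with
weights `w`. -/
noncomputable def tapeAverage {T : Type*} [Fintype T] (w : T → ℝ) :
    ℕ → ((ℕ → T) → ℝ) → (ℕ → T) → ℝ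
  | 0, F => F
  | j + 1, F => tapeAverage w j fun ω => ∑ t, w t * F (Function.update ω j t)

section TapeAverage

variable {T : Type*} [Fintype T] {w : T → ℝ}

theorem tapeAverage_mono (hw : ∀ t, 0 ≤ w t) (j : ℕ) {F G : (ℕ → T) → ℝ}
    (h : ∀ ω, F ω ≤ G ω) (ω : ℕ → T) : tapeAverage w j F ω ≤ tapeAverage w j G ω := by
  induction j generalizing F G with
  | zero => exact h ω
  | succ j ih =>
    exact ih fun ω => Finset.sum_le_sum fun t _ => mul_le_mul_of_nonneg_left (h _) (hw t)

theorem tapeAverage_const (hw : ∑ t, w t = 1) (j : ℕ) (c : ℝ) (ω : ℕ → T) :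
    tapeAverage w j (fun _ => c) ω = c := by
  induction j with
  | zero => rfl
  | succ j ih =>
    rw [tapeAverage]
    simp only [← Finset.sum_mul, hw, one_mul, ih]

theorem tapeAverage_affine (hw : ∑ t, w t = 1) (j : ℕ) (F : (ℕ → T) → ℝ) (a b : ℝ)
    (ω : ℕ → T) :
    tapeAverage w j (fun ω => a - b * F ω) ω = a - b * tapeAverage w j F ω := by
  induction j generalizing F with
  | zero => rfl
  | succ j ih =>
    rw [tapeAverage, tapeAverage, ← ih]
    congr 1
    funext ω'
    simp only [mul_sub, Finset.sum_sub_distrib, ← Finset.sum_mul, hw, Finset.mul_sum]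
    rw [one_mul]
    congr 1
    exact Finset.sum_congr rfl fun t _ => by ring

/-- Used to exchange the averages over tapes and samples; finiteness of `X` makes every integrand
integrable. -/
theorem tapeAverage_integral {X : Type*} [MeasurableSpace X] [Finite X]
    [MeasurableSingletonClass X] (μ : Measure X) [IsFiniteMeasure μ] (j : ℕ)
    (F : X → (ℕ → T) → ℝ) (ω : ℕ → T) :
    tapeAverage w j (fun ω => ∫ x, F x ω ∂μ) ω = ∫ x, tapeAverage w j (F x) ω ∂μ := by
  induction j generalizing F with
  | zero => rfl
  | succ j ih =>
    simp only [tapeAverage]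
    rw [← ih]
    congr 1
    funext ω'
    rw [integral_finsetSum _ fun t _ => Integrable.of_finite]
    exact Finset.sum_congr rfl fun t _ => (integral_const_mul _ _).symm

/-- Averages over the tape and the play do not decrease from one round to the next if they do
not decrease in each position. -/
theorem tapeAverage_integral_play_le_succ {d : ℕ} (M : Mechanism.{u} d) (hw : ∀ t, 0 ≤ w t)
    {st : (ℕ → T) → ∀ j, History d j → Query d} (hst : ∀ ω j, Measurable (st ω j)) {j : ℕ}
    (hupd : ∀ ω t, ∀ i < j, st (Function.update ω j t) i = st ω i)
    {F : (ℕ → T) → History d j → ℝ} {F' : (ℕ → T) → History d (j + 1) → ℝ} {C C' : ℝ}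
    (hF : ∀ ω, Measurable (F ω)) (hF' : ∀ ω, Measurable (F' ω))
    (hC : ∀ ω h, |F ω h| ≤ C) (hC' : ∀ ω h, |F' ω h| ≤ C')
    (hstep : ∀ ω h s, F ω h ≤ ∑ t, w t * ∫ r, F' (Function.update ω j t)
      (History.snoc h (st (Function.update ω j t) j h) r.1)
        ∂(M.step (st (Function.update ω j t) j h) s)) (ω : ℕ → T) :
    tapeAverage w j (fun ω => ∫ c, F ω c.1 ∂(play M (st ω) j)) ω ≤
      tapeAverage w (j + 1) (fun ω => ∫ c, F' ω c.1 ∂(play M (st ω) (j + 1))) ω := by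
  rw [tapeAverage]
  refine tapeAverage_mono hw j (fun ω => ?_) ω
  -- The first `j` rounds do not see entry `j`, so the average over `t` can be taken under one
  -- common law.
  have hplay : ∀ t, play M (st (Function.update ω j t)) j = play M (st ω) j :=
    fun t => play_congr M (hupd ω t)
  have hsucc := fun t => integral_play_succ M (hst (Function.update ω j t))
    (hF' (Function.update ω j t)) (hC' _)
  simp only [hplay] at hsucc
  rw [Finset.sum_congr rfl fun t _ => by rw [(hsucc t).2, ← integral_const_mul],
    ← integral_finsetSum _ fun t _ => (hsucc t).1.const_mul _]
  exact integral_mono (integrable_play M (hst ω) (hF ω) (hC ω))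
    (integrable_finsetSum _ fun t _ => (hsucc t).1.const_mul _)
    fun c => hstep ω c.1 c.2

end TapeAverage

/-! ### The fingerprinting inequality -/

/-- The law of one round of the attack: a grid point `p = l / m` is drawn uniformly and then
independent bits with mean `p`. -/
noncomputable def roundWeight {ι : Type*} [Fintype ι] {m : ℕ} (t : Fin m × (ι → Bool)) : ℝ :=
  1 / (m : ℝ) * bernoulliWeight ((t.1 : ℝ) / m) t.2

section RoundWeight

variable {ι : Type*} [Fintype ι] {m : ℕ}

theorem grid_nonneg (l : Fin m) : 0 ≤ (l : ℝ) / m := by positivity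

theorem grid_le_one (l : Fin m) : (l : ℝ) / m ≤ 1 :=
  div_le_one_of_le₀ (by exact_mod_cast l.2.le) (by positivity)

theorem abs_bit_sub_grid_le (b : Bool) (l : Fin m) : |bit b - (l : ℝ) / m| ≤ 1 :=
  abs_le.2 ⟨by linarith [bit_nonneg b, grid_le_one l], by linarith [bit_le_one b, grid_nonneg l]⟩

theorem roundWeight_nonneg (t : Fin m × (ι → Bool)) : 0 ≤ roundWeight t :=
  mul_nonneg (by positivity) (bernoulliWeight_nonneg (grid_nonneg _) (grid_le_one _) _)

theorem sum_roundWeight [DecidableEq ι] (hm : 0 < m) :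
    ∑ t : Fin m × (ι → Bool), roundWeight t = 1 := by
  have : (m : ℝ) ≠ 0 := by exact_mod_cast hm.ne'
  rw [Fintype.sum_prod_type]
  simp only [roundWeight, ← Finset.mul_sum, sum_bernoulliWeight]
  simp [this]

/-- The fingerprinting inequality: answers `g`, whatever they are, either correlate with the bits
on which they depend or are biased. -/
theorem fingerprinting_le [DecidableEq ι] {δ : ℝ}
    (hgrid : ∀ g : (ι → Bool) → ℝ, (∀ q, 0 ≤ g q) → (∀ q, g q ≤ 1) →
      -δ ≤ (1 / (m : ℝ)) * ∑ l : Fin m, ∑ q, bernoulliWeight ((l : ℝ) / m) q *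
        (g q * (∑ y, (bit (q y) - (l : ℝ) / m) + (1 - 2 * ((l : ℝ) / m)))))
    (hgrid' : 1 / 6 - δ ≤ (1 / (m : ℝ)) * ∑ l : Fin m, ((l : ℝ) / m) * (2 * ((l : ℝ) / m) - 1))
    (R A : Finset ι) {g : (ι → Bool) → ℝ} (hg0 : ∀ q, 0 ≤ g q) (hg1 : ∀ q, g q ≤ 1)
    (hg : ∀ y ∉ R, ∀ q, g (Function.update q y (!q y)) = g q) (b : ι → ℝ) :
    (1 / 6 - δ) * (A.card / Fintype.card ι) - δ ≤ ∑ t : Fin m × (ι → Bool), roundWeight t *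
      (g t.2 * (∑ y ∈ R, (bit (t.2 y) - (t.1 : ℝ) / m) + (1 - 2 * ((t.1 : ℝ) / m)) +
        ∑ y ∈ Rᶜ, b y * (bit (t.2 y) - (t.1 : ℝ) / m)) +
        (2 * ((t.1 : ℝ) / m) - 1) * ((∑ y ∈ A, bit (t.2 y)) / Fintype.card ι)) := by
  have hrow : ∀ p : ℝ, ∑ q : ι → Bool, bernoulliWeight p q *
      (g q * (∑ y ∈ R, (bit (q y) - p) + (1 - 2 * p) + ∑ y ∈ Rᶜ, b y * (bit (q y) - p)) +
        (2 * p - 1) * ((∑ y ∈ A, bit (q y)) / Fintype.card ι)) =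
      ∑ q : ι → Bool, bernoulliWeight p q * (g q * (∑ y, (bit (q y) - p) + (1 - 2 * p))) +
        p * (2 * p - 1) * (A.card / Fintype.card ι) := by
    intro p
    -- A bit outside `R` is uncorrelated with `g`, so its coefficient can be changed from 1 to `b y`
    -- for free.
    have hfree : ∑ q : ι → Bool, ∑ y ∈ Rᶜ,
        (b y - 1) * (bernoulliWeight p q * (g q * (bit (q y) - p))) = 0 := by
      rw [Finset.sum_comm]
      refine Finset.sum_eq_zero fun y hy => ?_
      rw [← Finset.mul_sum, sum_bernoulliWeight_mul_sub p y g (hg y (Finset.mem_compl.1 hy)),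
        mul_zero]
    have hval : ∑ q : ι → Bool, ∑ y ∈ A, bernoulliWeight p q * bit (q y) = A.card * p := by
      rw [Finset.sum_comm]
      simp [sum_bernoulliWeight_mul_bit]
    have hsplit : ∀ q : ι → Bool, bernoulliWeight p q *
        (g q * (∑ y ∈ R, (bit (q y) - p) + (1 - 2 * p) + ∑ y ∈ Rᶜ, b y * (bit (q y) - p)) +
          (2 * p - 1) * ((∑ y ∈ A, bit (q y)) / Fintype.card ι)) =
        bernoulliWeight p q * (g q * (∑ y, (bit (q y) - p) + (1 - 2 * p))) +
          ∑ y ∈ Rᶜ, (b y - 1) * (bernoulliWeight p q * (g q * (bit (q y) - p))) +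
          (2 * p - 1) / Fintype.card ι * ∑ y ∈ A, bernoulliWeight p q * bit (q y) := by
      intro q
      have h1 : ∑ y ∈ Rᶜ, (b y - 1) * (bernoulliWeight p q * (g q * (bit (q y) - p))) =
          bernoulliWeight p q * g q *
            (∑ y ∈ Rᶜ, b y * (bit (q y) - p) - ∑ y ∈ Rᶜ, (bit (q y) - p)) := by
        rw [← Finset.sum_sub_distrib, Finset.mul_sum]
        exact Finset.sum_congr rfl fun y _ => by ring
      rw [h1, ← Finset.mul_sum, ← Finset.sum_add_sum_compl R fun y => bit (q y) - p]
      ring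
    simp only [hsplit]
    rw [Finset.sum_add_distrib, Finset.sum_add_distrib, hfree, ← Finset.mul_sum, hval]
    ring
  rw [Fintype.sum_prod_type]
  simp only [roundWeight, mul_assoc (1 / (m : ℝ)), ← Finset.mul_sum, hrow]
  rw [Finset.sum_add_distrib, ← Finset.sum_mul, mul_add, ← mul_assoc]
  have := mul_le_mul_of_nonneg_right hgrid'
    (by positivity : (0 : ℝ) ≤ A.card / Fintype.card ι)
  linarith [hgrid g hg0 hg1]

end RoundWeight

/-! ### Scores, masked queries and the potential -/

section Attack

variable {m d : ℕ}

/-- The scores after `j` rounds: in every round in which the score of `y` is at most `σ`, the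
answer times the centred bit of `y` is added to it. -/
noncomputable def score (σ : ℝ) (ω : ℕ → Fin m × Query d) :
    (j : ℕ) → History d j → Point d → ℝ
  | 0, _, _ => 0
  | j + 1, h, y => score σ ω j (Fin.init h) y +
      if score σ ω j (Fin.init h) y ≤ σ then
        ((h (Fin.last j)).2 : ℝ) * (bit ((ω j).2 y) - ((ω j).1 : ℝ) / m) else 0

open Classical in
/-- The query `q`, set to `false` on the points whose score exceeds `σ`. -/
noncomputable def maskedQuery (σ : ℝ) (v : Point d → ℝ) (q : Query d) : Query d :=
  fun y => if v y ≤ σ then q y else false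

/-- The strategy of the attack. -/
noncomputable def attack (σ : ℝ) (ω : ℕ → Fin m × Query d) (j : ℕ) (h : History d j) : Query d :=
  maskedQuery σ (score σ ω j h) (ω j).2

theorem measurable_score (σ : ℝ) (ω : ℕ → Fin m × Query d) (j : ℕ) (y : Point d) :
    Measurable fun h => score σ ω j h y := by
  induction j with
  | zero => exact measurable_const
  | succ j ih =>
    have hinit : Measurable fun h : History d (j + 1) => score σ ω j (Fin.init h) y :=
      ih.comp (measurable_pi_lambda _ fun i => measurable_pi_apply _)
    refine hinit.add (Measurable.ite (measurableSet_le hinit measurable_const) ?_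
      measurable_const)
    exact (measurable_subtype_coe.comp (measurable_snd.comp (measurable_pi_apply _))).mul_const _

theorem measurable_attack (σ : ℝ) (ω : ℕ → Fin m × Query d) (j : ℕ) :
    Measurable (attack σ ω j) := by
  refine measurable_pi_lambda _ fun y => ?_
  exact Measurable.ite (measurableSet_le (measurable_score σ ω j y) measurable_const)
    measurable_const measurable_const

/-- Scores before round `j` use only earlier tape entries, so they stay fixed while entry `j` is
averaged. -/
theorem score_congr (σ : ℝ) {ω ω' : ℕ → Fin m × Query d} {j : ℕ} (hω : ∀ i < j, ω i = ω' i) :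
    score σ ω j = score σ ω' j := by
  induction j with
  | zero => rfl
  | succ j ih =>
    funext h y
    rw [score, score, ih fun i hi => hω i (hi.trans j.lt_succ_self), hω j j.lt_succ_self]

theorem score_update (σ : ℝ) (ω : ℕ → Fin m × Query d) (j : ℕ) (t : Fin m × Query d) :
    score σ (Function.update ω j t) j = score σ ω j :=
  score_congr σ fun i hi => by rw [Function.update_of_ne hi.ne]

theorem attack_update_of_lt (σ : ℝ) (ω : ℕ → Fin m × Query d) {i j : ℕ} (t : Fin m × Query d)
    (hi : i < j) : attack σ (Function.update ω j t) i = attack σ ω i := by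
  funext h
  rw [attack, attack, Function.update_of_ne hi.ne,
    score_congr σ fun l hl => by rw [Function.update_of_ne (hl.trans hi).ne]]

theorem attack_update_self (σ : ℝ) (ω : ℕ → Fin m × Query d) (j : ℕ) (t : Fin m × Query d)
    (h : History d j) :
    attack σ (Function.update ω j t) j h = maskedQuery σ (score σ ω j h) t.2 := by
  rw [attack, score_update, Function.update_self]

theorem score_succ_snoc (σ : ℝ) (ω : ℕ → Fin m × Query d) (j : ℕ) (t : Fin m × Query d)
    (h : History d j) (q : Query d) (a : unitInterval) (y : Point d) :
    score σ (Function.update ω j t) (j + 1) (h.snoc q a) y = score σ ω j h y +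
      if score σ ω j h y ≤ σ then (a : ℝ) * (bit (t.2 y) - (t.1 : ℝ) / m) else 0 := by
  have hlast : h.snoc q a (Fin.last j) = (q, a) := Fin.snoc_last _ _
  rw [score, Fin.init_snoc, hlast, score_update, Function.update_self]

theorem abs_answer_mul_le (a : unitInterval) (b : Bool) (l : Fin m) :
    |(a : ℝ) * (bit b - (l : ℝ) / m)| ≤ 1 := by
  rw [abs_mul, abs_of_nonneg a.2.1]
  exact mul_le_one₀ a.2.2 (abs_nonneg _) (abs_bit_sub_grid_le _ _)

theorem abs_score_le (σ : ℝ) (ω : ℕ → Fin m × Query d) (j : ℕ) (h : History d j) (y : Point d) :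
    |score σ ω j h y| ≤ j := by
  induction j with
  | zero => simp [score]
  | succ j ih =>
    rw [score]
    refine (abs_add_le _ _).trans ?_
    push_cast
    refine add_le_add (ih _) ?_
    split_ifs
    · exact abs_answer_mul_le _ _ _
    · simp

/-- A score moves only while it is at most `σ`, and by at most 1 at a time. -/
theorem score_le {σ : ℝ} (hσ : 0 ≤ σ) (ω : ℕ → Fin m × Query d) (j : ℕ) (h : History d j)
    (y : Point d) : score σ ω j h y ≤ σ + 1 := by
  induction j with
  | zero => rw [score]; linarith
  | succ j ih =>
    rw [score]
    split_ifs with hs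
    · exact add_le_add hs ((le_abs_self _).trans (abs_answer_mul_le _ _ _))
    · simpa using ih _

open Classical in
/-- The number of answers in a history with error above `α`. -/
noncomputable def inaccuracies (D : PMF (Point d)) (α : ℝ) {j : ℕ} (h : History d j) : ℝ :=
  ∑ i, if α < |((h i).2 : ℝ) - (h i).1.value D| then 1 else 0

theorem measurableSet_inaccurate (D : PMF (Point d)) (α : ℝ) {j : ℕ} (i : Fin j) :
    MeasurableSet {h : History d j | α < |((h i).2 : ℝ) - (h i).1.value D|} := by
  have hval : Measurable fun q : Query d => q.value D := Measurable.of_discrete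
  refine measurableSet_lt measurable_const (Measurable.abs ?_)
  exact (measurable_subtype_coe.comp (measurable_snd.comp (measurable_pi_apply i))).sub
    (hval.comp (measurable_fst.comp (measurable_pi_apply i)))

theorem measurable_inaccuracies (D : PMF (Point d)) (α : ℝ) {j : ℕ} :
    Measurable fun h : History d j => inaccuracies D α h :=
  Finset.measurable_fun_sum _ fun i _ =>
    Measurable.ite (measurableSet_inaccurate D α i) measurable_const measurable_const

theorem inaccuracies_nonneg (D : PMF (Point d)) (α : ℝ) {j : ℕ} (h : History d j) :
    0 ≤ inaccuracies D α h :=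
  Finset.sum_nonneg fun i _ => by split_ifs <;> norm_num

theorem inaccuracies_le (D : PMF (Point d)) (α : ℝ) {j : ℕ} (h : History d j) :
    inaccuracies D α h ≤ j := by
  refine (Finset.sum_le_card_nsmul _ _ 1 fun i _ => ?_).trans (by simp)
  split_ifs <;> norm_num

open Classical in
theorem inaccuracies_snoc (D : PMF (Point d)) (α : ℝ) {j : ℕ} (h : History d j) (q : Query d)
    (a : unitInterval) : inaccuracies D α (h.snoc q a) =
      inaccuracies D α h + if α < |(a : ℝ) - q.value D| then 1 else 0 := by
  rw [inaccuracies, Fin.sum_univ_castSucc]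
  simp only [Fin.snoc_castSucc, Fin.snoc_last]
  rfl

/-- The scores of the sample points plus the number of inaccuracies, corrected by the drift. -/
noncomputable def potential (σ α lam γ : ℝ) (k : ℕ) (S : Finset (Point d))
    (ω : ℕ → Fin m × Query d) (j : ℕ) (h : History d j) : ℝ :=
  ∑ y ∈ S, score σ ω j h y + inaccuracies (PMF.uniformOfFintype (Point d)) α h -
    lam * (k - j) * ((∑ y ∈ Sᶜ, score σ ω j h y ^ 2) / Fintype.card (Point d)) - γ * j

theorem measurable_potential (σ α lam γ : ℝ) (k : ℕ) (S : Finset (Point d))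
    (ω : ℕ → Fin m × Query d) (j : ℕ) : Measurable (potential σ α lam γ k S ω j) := by
  have h1 : Measurable fun h : History d j => ∑ y ∈ S, score σ ω j h y :=
    Finset.measurable_fun_sum _ fun y _ => measurable_score σ ω j y
  have h2 : Measurable fun h : History d j => ∑ y ∈ Sᶜ, score σ ω j h y ^ 2 :=
    Finset.measurable_fun_sum _ fun y _ => (measurable_score σ ω j y).pow_const 2
  exact ((h1.add (measurable_inaccuracies _ α)).sub
    ((h2.div_const _).const_mul _)).sub_const _

/-- A crude bound, needed only for integrability. -/
theorem exists_abs_potential_le (σ α lam γ : ℝ) (k : ℕ) (S : Finset (Point d)) (j : ℕ) :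
    ∃ C, ∀ (ω : ℕ → Fin m × Query d) h, |potential σ α lam γ k S ω j h| ≤ C := by
  refine ⟨S.card * j + j + |lam * (k - j)| *
    ((Sᶜ.card * j ^ 2) / Fintype.card (Point d)) + |γ * j|, fun ω h => ?_⟩
  refine (abs_sub _ _).trans (add_le_add ((abs_sub _ _).trans (add_le_add
    ((abs_add_le _ _).trans (add_le_add ?_ ?_)) ?_)) le_rfl)
  · refine (Finset.abs_sum_le_sum_abs _ _).trans ?_
    refine (Finset.sum_le_card_nsmul _ _ _ fun y _ => abs_score_le σ ω j h y).trans (by simp)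
  · rw [abs_of_nonneg (inaccuracies_nonneg _ _ _)]
    exact inaccuracies_le _ _ _
  · rw [abs_mul, abs_of_nonneg (a := _ / _) (by positivity)]
    gcongr
    refine (Finset.sum_le_card_nsmul _ _ ((j : ℝ) ^ 2) fun y _ => ?_).trans (by simp)
    exact sq_le_sq' (by linarith [abs_le.1 (abs_score_le σ ω j h y)])
      (abs_le.1 (abs_score_le σ ω j h y)).2

end Attack

/-! ### Change of the potential in one round -/

section Attack

variable {m d : ℕ}

theorem value_uniformOfFintype (q : Query d) :
    q.value (PMF.uniformOfFintype (Point d)) = (∑ y, bit (q y)) / Fintype.card (Point d) := by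
  rw [Query.value, Finset.sum_div]
  refine Finset.sum_congr rfl fun y _ => ?_
  rw [PMF.uniformOfFintype_apply, ENNReal.toReal_inv, ENNReal.toReal_natCast, bit]
  ring

open Classical in
theorem value_maskedQuery (σ : ℝ) (v : Point d → ℝ) (q : Query d) :
    (maskedQuery σ v q).value (PMF.uniformOfFintype (Point d)) =
      (∑ y with v y ≤ σ, bit (q y)) / Fintype.card (Point d) := by
  rw [value_uniformOfFintype, Finset.sum_filter]
  congr 1
  refine Finset.sum_congr rfl fun y _ => ?_
  rw [maskedQuery]
  split_ifs <;> simp [bit]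

theorem value_uniformOfFintype_mem (q : Query d) :
    q.value (PMF.uniformOfFintype (Point d)) ∈ Set.Icc (0 : ℝ) 1 := by
  rw [value_uniformOfFintype]
  refine ⟨div_nonneg (Finset.sum_nonneg fun y _ => bit_nonneg _) (by positivity),
    div_le_one_of_le₀ ?_ (by positivity)⟩
  exact (Finset.sum_le_card_nsmul _ _ 1 fun y _ => bit_le_one _).trans (by simp)

open Classical in
/-- A lower bound, affine in the answer, for the potential after one more round. -/
theorem le_potential_succ (σ α lam γ : ℝ) {k : ℕ} (S : Finset (Point d))
    (hα : 0 ≤ α) (hlam : 0 ≤ lam) (ω : ℕ → Fin m × Query d) {j : ℕ} (hj : j < k) (h : History d j)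
    (t : Fin m × Query d) (a : unitInterval) :
    potential σ α lam γ k S ω j h +
      (lam * ((∑ y ∈ Sᶜ, score σ ω j h y ^ 2) / Fintype.card (Point d)) -
        lam * (k - j - 1) - α - γ) +
      ((a : ℝ) * (∑ y ∈ S with score σ ω j h y ≤ σ, (bit (t.2 y) - (t.1 : ℝ) / m) +
          (1 - 2 * ((t.1 : ℝ) / m)) +
        ∑ y ∈ (S.filter fun y => score σ ω j h y ≤ σ)ᶜ,
          (if y ∈ S then 0 else if score σ ω j h y ≤ σ then
            -(2 * (lam * (k - j - 1)) / Fintype.card (Point d) * score σ ω j h y) else 0) *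
              (bit (t.2 y) - (t.1 : ℝ) / m)) +
      (2 * ((t.1 : ℝ) / m) - 1) * ((∑ y with score σ ω j h y ≤ σ, bit (t.2 y)) /
        Fintype.card (Point d))) ≤
    potential σ α lam γ k S (Function.update ω j t) (j + 1)
      (h.snoc (maskedQuery σ (score σ ω j h) t.2) a) := by
  set N : ℝ := ((Fintype.card (Point d) : ℕ) : ℝ) with hN
  have hNpos : 0 < N := by rw [hN]; exact_mod_cast Fintype.card_pos
  set u := score σ ω j h with hu
  set p : ℝ := (t.1 : ℝ) / m with hp
  set lam' := lam * (k - j - 1) with hlam'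
  have hlam'0 : 0 ≤ lam' := by
    refine mul_nonneg hlam ?_
    have : (j : ℝ) + 1 ≤ k := by exact_mod_cast hj
    linarith
  have hZ : ∑ y ∈ S, score σ (Function.update ω j t) (j + 1)
      (h.snoc (maskedQuery σ u t.2) a) y =
      ∑ y ∈ S, u y + a * ∑ y ∈ S with u y ≤ σ, (bit (t.2 y) - p) := by
    simp only [score_succ_snoc, ← hu, ← hp]
    rw [Finset.sum_add_distrib, ← Finset.sum_filter, Finset.mul_sum]
  -- In the expanded squares the quadratic terms cost at most 1 per point; the linear terms are kept
  -- exactly, since they average to zero later.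
  have hV : ∑ y ∈ Sᶜ, score σ (Function.update ω j t) (j + 1)
      (h.snoc (maskedQuery σ u t.2) a) y ^ 2 ≤
      ∑ y ∈ Sᶜ, u y ^ 2 + N +
        a * ∑ y ∈ Sᶜ, (if u y ≤ σ then 2 * u y else 0) * (bit (t.2 y) - p) := by
    have hcard : ∑ y ∈ Sᶜ, (1 : ℝ) ≤ N := by
      rw [Finset.sum_const, nsmul_eq_mul, mul_one, hN]
      exact_mod_cast Finset.card_le_univ _
    have hterm : ∀ y ∈ Sᶜ, score σ (Function.update ω j t) (j + 1)
        (h.snoc (maskedQuery σ u t.2) a) y ^ 2 ≤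
        u y ^ 2 + 1 + a * ((if u y ≤ σ then 2 * u y else 0) * (bit (t.2 y) - p)) := by
      intro y _
      rw [score_succ_snoc, ← hu, ← hp]
      split_ifs
      · have := (sq_le_one_iff_abs_le_one _).2 (abs_answer_mul_le a (t.2 y) t.1)
        rw [← hp] at this
        linarith
      · simp
    refine (Finset.sum_le_sum hterm).trans ?_
    rw [Finset.sum_add_distrib, Finset.sum_add_distrib, ← Finset.mul_sum]
    linarith
  -- Masked sample points lie in this complement too; their coefficient is 0, so only the linear
  -- terms of the squares remain.
  have hb : ∑ y ∈ (S.filter fun y => u y ≤ σ)ᶜ,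
      (if y ∈ S then 0 else if u y ≤ σ then -(2 * lam' / N * u y) else 0) * (bit (t.2 y) - p) =
      -(lam' / N) * ∑ y ∈ Sᶜ, (if u y ≤ σ then 2 * u y else 0) * (bit (t.2 y) - p) := by
    rw [Finset.mul_sum]
    have hsub : Sᶜ ⊆ (S.filter fun y => u y ≤ σ)ᶜ :=
      Finset.compl_subset_compl.2 (Finset.filter_subset _ _)
    rw [← Finset.sum_subset hsub fun y _ hy => by simp [Finset.mem_compl.not_left.1 hy]]
    refine Finset.sum_congr rfl fun y hy => ?_
    rw [if_neg (Finset.mem_compl.1 hy)]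
    split_ifs <;> ring
  set v := (maskedQuery σ u t.2).value (PMF.uniformOfFintype (Point d)) with hv
  -- As |1-2p| ≤ 1, the bias is at most the error: at most α in an accurate round, at most 1 in any
  -- other.
  have hI : (1 - 2 * p) * (a - v) - α ≤ if α < |(a : ℝ) - v| then 1 else 0 := by
    have h0 := value_uniformOfFintype_mem (maskedQuery σ u t.2)
    rw [← hv] at h0
    have hav : |(a : ℝ) - v| ≤ 1 :=
      abs_le.2 ⟨by linarith [a.2.1, h0.2], by linarith [a.2.2, h0.1]⟩
    have hpp : |1 - 2 * p| ≤ 1 :=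
      abs_le.2 ⟨by linarith [grid_le_one t.1], by linarith [grid_nonneg t.1]⟩
    have hle : (1 - 2 * p) * (a - v) ≤ |(a : ℝ) - v| := by
      refine (le_abs_self _).trans ?_
      rw [abs_mul]
      exact mul_le_of_le_one_left (abs_nonneg _) hpp
    split_ifs with hαv
    · linarith
    · linarith [not_lt.1 hαv]
  rw [← value_maskedQuery, ← hv, hb, potential, potential, hZ, inaccuracies_snoc, ← hv, ← hu]
  have hV' := mul_le_mul_of_nonneg_left hV (div_nonneg hlam'0 hNpos.le)
  have hk : lam * (k - j) = lam' + lam := by rw [hlam']; ring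
  have hk' : lam * ((k : ℝ) - ((j + 1 : ℕ) : ℝ)) = lam' := by rw [hlam']; push_cast; ring
  rw [hk, hk']
  have e1 : ∀ x z : ℝ, lam' / N * (x + N + a * z) =
      lam' * (x / N) + lam' + a * (lam' / N * z) := fun x z => by field_simp
  rw [e1] at hV'
  have e2 : ∀ x : ℝ, lam' * (x / N) = lam' / N * x := fun x => by ring
  rw [e2 (∑ y ∈ Sᶜ, score σ _ _ _ y ^ 2)]
  push_cast
  linarith

end Attack

/-! ### The submartingale property against a natural oracle -/

section Attack

variable {m d : ℕ}

/-- A natural oracle's answers depend only on the bits of the sample points. -/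
theorem Oracle.IsNatural.integral_answer_eq {O : Oracle.{u}} (hO : O.IsNatural) {n : ℕ}
    (x : Fin n → Point d) {q q' : Query d} (hq : ∀ i, q (x i) = q' (x i))
    (s : (O.hold x).State) :
    ∫ r, (r.1 : ℝ) ∂((O.hold x).step q s) = ∫ r, (r.1 : ℝ) ∂((O.hold x).step q' s) := by
  have hmap : ∀ q, ∫ r, (r.1 : ℝ) ∂((O.hold x).step q s) =
      ∫ a : unitInterval, (a : ℝ) ∂(((O.hold x).step q s).map Prod.fst) := fun q =>
    (integral_map measurable_fst.aemeasurable
      measurable_subtype_coe.aestronglyMeasurable).symm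
  rw [hmap, hmap, hO n d x q q' hq s]

theorem integrable_answer (M : Mechanism.{u} d) (q : Query d) (s : M.State) :
    Integrable (fun r : unitInterval × M.State => (r.1 : ℝ)) (M.step q s) :=
  Integrable.of_bound
    (measurable_subtype_coe.comp measurable_fst).aestronglyMeasurable 1
    (Eventually.of_forall fun r => by
      rw [Real.norm_eq_abs, abs_of_nonneg r.1.2.1]; exact r.1.2.2)

theorem integrable_affine_answer (M : Mechanism.{u} d) (q : Query d) (s : M.State)
    (a b c : ℝ) : Integrable (fun r : unitInterval × M.State => a + ((r.1 : ℝ) * b + c))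
      (M.step q s) :=
  (integrable_const a).add (((integrable_answer M q s).mul_const b).add (integrable_const c))

theorem integral_affine_answer (M : Mechanism.{u} d) (q : Query d) (s : M.State) (a b c : ℝ) :
    ∫ r, (a + ((r.1 : ℝ) * b + c)) ∂(M.step q s) =
      a + ((∫ r, (r.1 : ℝ) ∂(M.step q s)) * b + c) := by
  have hans := (integrable_answer M q s).mul_const b
  have hans' : Integrable (fun r : unitInterval × M.State => (r.1 : ℝ) * b + c) (M.step q s) :=
    hans.add (integrable_const c)
  rw [integral_add (integrable_const a) hans', integral_add hans (integrable_const c),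
    integral_mul_const]
  simp

open Classical in
/-- Against a natural oracle, the potential does not decrease on average. -/
theorem potential_le_average {O : Oracle.{u}} (hO : O.IsNatural) {n : ℕ} (x : Fin n → Point d)
    (hm : 0 < m) {δ : ℝ} (hδ : δ ≤ 1 / 6)
    (hgrid : ∀ g : (Point d → Bool) → ℝ, (∀ q, 0 ≤ g q) → (∀ q, g q ≤ 1) →
      -δ ≤ (1 / (m : ℝ)) * ∑ l : Fin m, ∑ q, bernoulliWeight ((l : ℝ) / m) q *
        (g q * (∑ y, (bit (q y) - (l : ℝ) / m) + (1 - 2 * ((l : ℝ) / m)))))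
    (hgrid' : 1 / 6 - δ ≤ (1 / (m : ℝ)) * ∑ l : Fin m, ((l : ℝ) / m) * (2 * ((l : ℝ) / m) - 1))
    {σ α lam γ : ℝ} {k : ℕ} (hσ : 0 < σ) (hα : 0 ≤ α) (hlam : 1 / 6 - δ ≤ lam * σ ^ 2)
    (hγ : γ ≤ (1 / 6 - δ) * (1 - n / Fintype.card (Point d)) - α - δ - lam * k)
    (ω : ℕ → Fin m × Query d) {j : ℕ} (hj : j < k) (h : History d j) (s : (O.hold x).State) :
    potential σ α lam γ k (Finset.univ.image x) ω j h ≤ ∑ t : Fin m × Query d, roundWeight t *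
      ∫ r, potential σ α lam γ k (Finset.univ.image x) (Function.update ω j t) (j + 1)
        (h.snoc (attack σ (Function.update ω j t) j h) r.1)
          ∂((O.hold x).step (attack σ (Function.update ω j t) j h) s) := by
  set S := Finset.univ.image x with hS
  set N : ℝ := ((Fintype.card (Point d) : ℕ) : ℝ) with hN
  have hNpos : 0 < N := by rw [hN]; exact_mod_cast Fintype.card_pos
  set u := score σ ω j h with hu
  have hlam0 : 0 ≤ lam := by
    by_contra hneg
    nlinarith [sq_nonneg σ, sq_pos_of_pos hσ]
  set A : Finset (Point d) := Finset.univ.filter fun y => u y ≤ σ with hA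
  set R : Finset (Point d) := S.filter fun y => u y ≤ σ with hR
  set V : ℝ := (∑ y ∈ Sᶜ, u y ^ 2) / N with hV
  set g : (Point d → Bool) → ℝ := fun q =>
    ∫ r, (r.1 : ℝ) ∂((O.hold x).step (maskedQuery σ u q) s) with hg
  have hg0 : ∀ q, 0 ≤ g q := fun q => integral_nonneg fun r => r.1.2.1
  have hg1 : ∀ q, g q ≤ 1 := fun q => by
    have := integral_mono (integrable_answer (O.hold x) (maskedQuery σ u q) s)
      (integrable_const 1) fun r => r.1.2.2
    simpa using this
  -- Naturalness enters here: a point outside `R` is off the sample or masked, so flipping its bit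
  -- leaves the masked query unchanged on the sample.
  have hgR : ∀ y ∉ R, ∀ q, g (Function.update q y (!q y)) = g q := by
    intro y hy q
    refine hO.integral_answer_eq x (fun i => ?_) s
    rw [maskedQuery, maskedQuery]
    split_ifs with hi
    · rw [Function.update_of_ne]
      rintro rfl
      exact hy (Finset.mem_filter.2 ⟨Finset.mem_image_of_mem x (Finset.mem_univ i), hi⟩)
    · rfl
  set b : Point d → ℝ := fun y => if y ∈ S then 0 else if u y ≤ σ then
    -(2 * (lam * (k - j - 1)) / N * u y) else 0 with hb
  have hfp := fingerprinting_le hgrid hgrid' R A hg0 hg1 hgR b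
  have hstep : ∀ t : Fin m × Query d,
      potential σ α lam γ k S ω j h + (lam * V - lam * (k - j - 1) - α - γ) +
        (g t.2 * (∑ y ∈ R, (bit (t.2 y) - (t.1 : ℝ) / m) + (1 - 2 * ((t.1 : ℝ) / m)) +
          ∑ y ∈ Rᶜ, b y * (bit (t.2 y) - (t.1 : ℝ) / m)) +
        (2 * ((t.1 : ℝ) / m) - 1) * ((∑ y ∈ A, bit (t.2 y)) / Fintype.card (Point d))) ≤
      ∫ r, potential σ α lam γ k S (Function.update ω j t) (j + 1)
        (h.snoc (attack σ (Function.update ω j t) j h) r.1)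
          ∂((O.hold x).step (attack σ (Function.update ω j t) j h) s) := by
    intro t
    rw [attack_update_self, ← hu]
    obtain ⟨C, hC⟩ := exists_abs_potential_le (m := m) σ α lam γ k S (j + 1)
    have hint : Integrable (fun r : unitInterval × (O.hold x).State =>
        potential σ α lam γ k S (Function.update ω j t) (j + 1)
          (h.snoc (maskedQuery σ u t.2) r.1)) ((O.hold x).step (maskedQuery σ u t.2) s) :=
      Integrable.of_bound (((measurable_potential σ α lam γ k S _ (j + 1)).comp
        (measurable_history_snoc h _)).comp measurable_fst).aestronglyMeasurable C
        (Eventually.of_forall fun r => hC _ _)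
    rw [hg, ← integral_affine_answer]
    exact integral_mono (integrable_affine_answer _ _ _ _ _ _) hint
      fun r => le_potential_succ σ α lam γ S hα hlam0 ω hj h t r.1
  refine le_trans ?_ (Finset.sum_le_sum fun t _ =>
    mul_le_mul_of_nonneg_left (hstep t) (roundWeight_nonneg t))
  simp only [mul_add (roundWeight _) (_ + _) (_ + _)]
  rw [Finset.sum_add_distrib, ← Finset.sum_mul, sum_roundWeight hm, one_mul]
  refine le_trans ?_ (add_le_add_right hfp _)
  -- Chebyshev: a masked point outside the sample contributes at least 1 to Σu²/σ².
  have hcount : N ≤ A.card + n + N * V / σ ^ 2 := by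
    have hNV : N * V = ∑ y ∈ Sᶜ, u y ^ 2 := by rw [hV]; field_simp
    have hScard : (S.card : ℝ) ≤ n := by
      exact_mod_cast Finset.card_image_le.trans (by simp)
    have h1 : (Sᶜ.card : ℝ) ≤ A.card + N * V / σ ^ 2 := by
      rw [hNV, hA, Finset.sum_div, Finset.card_filter]
      push_cast
      have hsub := Finset.sum_le_sum_of_subset_of_nonneg (Finset.subset_univ Sᶜ)
        (f := fun y => if u y ≤ σ then (1 : ℝ) else 0)
        fun y _ _ => by positivity
      refine le_trans ?_ (add_le_add_left hsub _)
      rw [← Finset.sum_add_distrib, ← nsmul_one, ← Finset.sum_const]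
      refine Finset.sum_le_sum fun y _ => ?_
      split_ifs with hy
      · linarith [show 0 ≤ u y ^ 2 / σ ^ 2 by positivity]
      · rw [zero_add, one_le_div (by positivity)]
        exact pow_le_pow_left₀ hσ.le (not_le.1 hy).le 2
    have h2 : (Sᶜ.card : ℝ) = N - S.card := by
      rw [Finset.card_compl, Nat.cast_sub (Finset.card_le_univ _)]
    linarith
  -- The amount lam·V released by the falling weight covers the loss from masked points.
  have hVσ : (1 / 6 - δ) * (V / σ ^ 2) ≤ lam * V := by
    have hV0 : 0 ≤ V := by positivity
    rw [mul_div_assoc', div_le_iff₀ (by positivity)]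
    nlinarith
  have hA' : (1 / 6 - δ) * (1 - n / N - V / σ ^ 2) ≤ (1 / 6 - δ) * (A.card / N) := by
    refine mul_le_mul_of_nonneg_left ?_ (by linarith)
    rw [le_div_iff₀ hNpos]
    have : (1 - n / N - V / σ ^ 2) * N = N - n - N * V / σ ^ 2 := by field_simp
    linarith
  have hk : lam * (k - j - 1) ≤ lam * k :=
    mul_le_mul_of_nonneg_left (by linarith [(Nat.cast_nonneg j : (0 : ℝ) ≤ j)]) hlam0
  rw [← hN]
  nlinarith

end Attack

/-! ### From the potential to the probability of accuracy -/

section Attack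

variable {m d : ℕ}

theorem measurableSet_accurate {X : Type*} [MeasurableSpace X] (D : PMF (Point d)) (α : ℝ)
    (k : ℕ) : MeasurableSet {c : History d k × X |
      ∀ j : Fin k, |((c.1 j).2 : ℝ) - (c.1 j).1.value D| ≤ α} := by
  rw [Set.ofPred_forall]
  refine MeasurableSet.iInter fun i => ?_
  have := (measurableSet_inaccurate D α i).compl.preimage
    (measurable_fst : Measurable (Prod.fst : History d k × X → History d k))
  convert this using 1
  ext c
  simp

/-- Whatever sample a natural oracle holds, the attack finds it inaccurate with substantial
probability. -/
theorem average_accurate_le {O : Oracle.{u}} (hO : O.IsNatural) {n : ℕ} (x : Fin n → Point d)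
    (hm : 0 < m) {δ : ℝ} (hδ : δ ≤ 1 / 6)
    (hgrid : ∀ g : (Point d → Bool) → ℝ, (∀ q, 0 ≤ g q) → (∀ q, g q ≤ 1) →
      -δ ≤ (1 / (m : ℝ)) * ∑ l : Fin m, ∑ q, bernoulliWeight ((l : ℝ) / m) q *
        (g q * (∑ y, (bit (q y) - (l : ℝ) / m) + (1 - 2 * ((l : ℝ) / m)))))
    (hgrid' : 1 / 6 - δ ≤ (1 / (m : ℝ)) * ∑ l : Fin m, ((l : ℝ) / m) * (2 * ((l : ℝ) / m) - 1))
    {σ α lam γ : ℝ} {k : ℕ} (hσ : 0 < σ) (hα : 0 ≤ α) (hlam : 1 / 6 - δ ≤ lam * σ ^ 2)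
    (hγ : γ ≤ (1 / 6 - δ) * (1 - n / Fintype.card (Point d)) - α - δ - lam * k)
    (ω : ℕ → Fin m × Query d) :
    k * tapeAverage roundWeight k (fun ω => (play (O.hold x) (attack σ ω) k).real
      {c | ∀ j : Fin k, |((c.1 j).2 : ℝ) -
        (c.1 j).1.value (PMF.uniformOfFintype (Point d))| ≤ α}) ω ≤
      n * (σ + 1) + k * (1 - γ) := by
  classical
  set S := Finset.univ.image x with hS
  have hmain : ∀ j ≤ k, 0 ≤ tapeAverage roundWeight j (fun ω => ∫ c,
      potential σ α lam γ k S ω j c.1 ∂(play (O.hold x) (attack σ ω) j)) ω := by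
    intro j
    induction j with
    | zero =>
      intro _
      simp [tapeAverage, potential, score, inaccuracies]
    | succ j ih =>
      intro hj
      obtain ⟨C, hC⟩ := exists_abs_potential_le (m := m) σ α lam γ k S j
      obtain ⟨C', hC'⟩ := exists_abs_potential_le (m := m) σ α lam γ k S (j + 1)
      refine (ih (Nat.le_of_succ_le hj)).trans
        (tapeAverage_integral_play_le_succ (O.hold x) roundWeight_nonneg
          (measurable_attack σ) (fun ω t i hi => attack_update_of_lt σ ω t hi)
          (fun ω => measurable_potential σ α lam γ k S ω j)
          (fun ω => measurable_potential σ α lam γ k S ω (j + 1)) hC hC' ?_ ω)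
      exact fun ω h s =>
        potential_le_average hO x hm hδ hgrid hgrid' hσ hα hlam hγ ω hj h s
  set acc : Set (History d k × (O.hold x).State) := {c | ∀ j : Fin k, |((c.1 j).2 : ℝ) -
        (c.1 j).1.value (PMF.uniformOfFintype (Point d))| ≤ α} with hacc
  have haccm : MeasurableSet acc := measurableSet_accurate _ α k
  have hupper : ∀ ω : ℕ → Fin m × Query d,
      ∫ c, potential σ α lam γ k S ω k c.1 ∂(play (O.hold x) (attack σ ω) k) ≤
        (n * (σ + 1) + k * (1 - γ)) - k * (play (O.hold x) (attack σ ω) k).real acc := by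
    intro ω
    have := isProbabilityMeasure_play (O.hold x) (attack σ ω) (measurable_attack σ ω) k
    obtain ⟨C, hC⟩ := exists_abs_potential_le (m := m) σ α lam γ k S k
    have hind : Integrable (acc.indicator fun _ => (k : ℝ))
        (play (O.hold x) (attack σ ω) k) := (integrable_const _).indicator haccm
    have hpt : ∀ c : History d k × (O.hold x).State, potential σ α lam γ k S ω k c.1 ≤
        (n * (σ + 1) + k * (1 - γ)) - acc.indicator (fun _ => (k : ℝ)) c := by
      intro c
      have hZ : ∑ y ∈ S, score σ ω k c.1 y ≤ n * (σ + 1) := by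
        refine (Finset.sum_le_card_nsmul _ _ _ fun y _ => score_le hσ.le ω k c.1 y).trans ?_
        rw [nsmul_eq_mul]
        refine mul_le_mul_of_nonneg_right ?_ (by linarith)
        exact_mod_cast Finset.card_image_le.trans (by simp)
      have hI := inaccuracies_le (PMF.uniformOfFintype (Point d)) α c.1
      -- After `k` rounds the weight of the squared scores is 0.
      rw [potential, sub_self, mul_zero, zero_mul, sub_zero]
      by_cases hc : c ∈ acc
      · rw [Set.indicator_of_mem hc]
        have h0 : inaccuracies (PMF.uniformOfFintype (Point d)) α c.1 = 0 :=
          Finset.sum_eq_zero fun i _ => if_neg (not_lt.2 (hc i))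
        linarith
      · rw [Set.indicator_of_notMem hc]
        linarith
    refine (integral_mono (integrable_play (O.hold x) (measurable_attack σ ω)
      (measurable_potential σ α lam γ k S ω k) (hC ω))
      ((integrable_const _).sub hind) hpt).trans (le_of_eq ?_)
    rw [integral_sub' (integrable_const _) hind, integral_indicator_const _ haccm]
    simp [mul_comm]
  have := (hmain k le_rfl).trans (tapeAverage_mono roundWeight_nonneg k hupper ω)
  rw [tapeAverage_affine (sum_roundWeight hm)] at this
  linarith

/-- The adversary that chooses the uniform distribution and plays a fixed strategy. -/
noncomputable def strategyAdversary (st : ∀ j, History d j → Query d)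
    (hst : ∀ j, Measurable (st j)) : Adversary d where
  Tape := Unit
  law := Measure.dirac ()
  dist _ := PMF.uniformOfFintype (Point d)
  measurable_dist _ := measurable_const
  query j _ := st j
  measurable_query j := (hst j).comp measurable_snd

theorem accuracyProb_strategyAdversary (O : Oracle.{u}) (st : ∀ j, History d j → Query d)
    (hst : ∀ j, Measurable (st j)) (n k : ℕ) (α : ℝ) :
    accuracyProb O (strategyAdversary st hst) n k α = ENNReal.ofReal
      (∫ x : Fin n → Point d, (play (O.hold x) st k).real
        {c | ∀ j : Fin k, |((c.1 j).2 : ℝ) -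
          (c.1 j).1.value (PMF.uniformOfFintype (Point d))| ≤ α}
        ∂(Measure.pi fun _ => (PMF.uniformOfFintype (Point d)).toMeasure)) := by
  have h : accuracyProb O (strategyAdversary st hst) n k α =
      ∫⁻ x : Fin n → Point d, play (O.hold x) st k
        {c | ∀ j : Fin k, |((c.1 j).2 : ℝ) -
          (c.1 j).1.value (PMF.uniformOfFintype (Point d))| ≤ α}
        ∂(Measure.pi fun _ => (PMF.uniformOfFintype (Point d)).toMeasure) :=
    lintegral_dirac (α := Unit) () _
  rw [h, ofReal_integral_eq_lintegral_ofReal Integrable.of_finite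
    (Eventually.of_forall fun x => measureReal_nonneg)]
  refine lintegral_congr fun x => ?_
  have := isProbabilityMeasure_play (O.hold x) st hst k
  exact (ofReal_measureReal).symm

end Attack

/-! ### Choice of parameters and contradiction -/

theorem Oracle.IsNatural.not_isAccurate_cube {O : Oracle.{u}} (hO : O.IsNatural) :
    ¬ O.IsAccurate (1 / 2000) (fun n _ => n ^ 3) := by
  rintro ⟨β, hβ, hacc⟩
  obtain ⟨n, hβn, hn⟩ :=
    ((hβ.eventually (gt_mem_nhds (by norm_num : (0 : ℝ) < 1 / 10))).and
      (eventually_ge_atTop (10 ^ 6))).exists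
  have hn' : (10 ^ 6 : ℝ) ≤ n := by exact_mod_cast hn
  have hn0 : (0 : ℝ) < n := by linarith
  -- Dimension d = n suffices: the sample fills at most 1/100 of the cube.
  have hcard : (100 * n : ℝ) ≤ Fintype.card (Point n) := by
    have h1 : n - 10 < 2 ^ (n - 10) := Nat.lt_two_pow_self
    have h2 : 2 ^ n = 2 ^ 10 * 2 ^ (n - 10) := by rw [← pow_add]; congr 1; omega
    have h3 : 100 * n ≤ 2 ^ n := by omega
    simp only [Point, Fintype.card_fun, Fintype.card_bool, Fintype.card_fin]
    exact_mod_cast h3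
  obtain ⟨m, hm, hgrid, hgrid'⟩ := exists_grid (ι := Point n) (δ := 1 / 100) (by norm_num)
  -- An arbitrary base tape: its first n³ entries are averaged away and the later ones are never
  -- read.
  let ω₀ : ℕ → Fin m × Query n := fun _ => (⟨0, hm⟩, fun _ => false)
  set σ : ℝ := (n : ℝ) ^ 2 / 100 with hσ
  have hσ0 : 0 < σ := by positivity
  -- Here lam·σ² = 1/6 and lam·k = 10⁴/(6n) ≤ 1/600, so the drift is at least (1/6 - 1/100)(99/100)
  -- - 1/2000 - 1/100 - 1/600 > 7/50.
  have hbound := fun x : Fin n → Point n => average_accurate_le (k := n ^ 3)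
    (α := 1 / 2000) (σ := σ) (lam := 1 / (6 * σ ^ 2)) (γ := 7 / 50) hO x hm
    (by norm_num) hgrid hgrid' hσ0 (by norm_num) (by
      rw [show 1 / (6 * σ ^ 2) * σ ^ 2 = 1 / 6 by field_simp]; norm_num) (by
      have h1 : (n : ℝ) / Fintype.card (Point n) ≤ 1 / 100 := by
        rw [div_le_div_iff₀ (by linarith) (by norm_num)]; linarith
      have h2 : 1 / (6 * σ ^ 2) * ((n ^ 3 : ℕ) : ℝ) ≤ 1 / 600 := by
        have : 1 / (6 * σ ^ 2) * ((n ^ 3 : ℕ) : ℝ) = 10000 / (6 * n) := by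
          rw [hσ]; push_cast; field_simp; norm_num
        rw [this, div_le_div_iff₀ (by positivity) (by norm_num)]
        linarith
      linarith) ω₀
  have hle : ∀ x : Fin n → Point n, tapeAverage roundWeight (n ^ 3)
      (fun ω => (play (O.hold x) (attack σ ω) (n ^ 3)).real {c | ∀ j : Fin (n ^ 3),
        |((c.1 j).2 : ℝ) - (c.1 j).1.value (PMF.uniformOfFintype (Point n))| ≤ 1 / 2000})
        ω₀ ≤ 9 / 10 := by
    intro x
    have hk : (0 : ℝ) < ((n ^ 3 : ℕ) : ℝ) := by push_cast; positivity
    refine le_of_mul_le_mul_left ((hbound x).trans ?_) hk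
    -- The bound becomes 1/50 + 43/50 < 9/10, against the lower bound 1 - β(n) > 9/10.
    have : (n : ℝ) * (σ + 1) ≤ 1 / 50 * ((n ^ 3 : ℕ) : ℝ) := by
      rw [hσ]; push_cast; nlinarith [mul_pos hn0 hn0]
    linarith
  have hlow : ∀ ω : ℕ → Fin m × Query n, 1 - β n ≤
      ∫ x : Fin n → Point n, (play (O.hold x) (attack σ ω) (n ^ 3)).real
        {c | ∀ j : Fin (n ^ 3), |((c.1 j).2 : ℝ) -
          (c.1 j).1.value (PMF.uniformOfFintype (Point n))| ≤ 1 / 2000}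
        ∂(Measure.pi fun _ => (PMF.uniformOfFintype (Point n)).toMeasure) := by
    intro ω
    have h := hacc n n (strategyAdversary (attack σ ω) (measurable_attack σ ω))
    rw [accuracyProb_strategyAdversary] at h
    exact (ENNReal.ofReal_le_ofReal_iff (integral_nonneg fun x => measureReal_nonneg)).1 h
  have havg := tapeAverage_mono roundWeight_nonneg (n ^ 3) hlow ω₀
  rw [tapeAverage_const (sum_roundWeight hm), tapeAverage_integral] at havg
  have hfin := integral_mono (μ := Measure.pi fun _ : Fin n =>
    (PMF.uniformOfFintype (Point n)).toMeasure) Integrable.of_finite (integrable_const _) hle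
  rw [integral_const, probReal_univ, one_smul] at hfin
  linarith

end AdaptiveSQ

theorem mainTheorem4 :
    ∃ k : ℕ → ℕ, AdaptiveSQ.IsPowerUpToLittleO k 3 ∧
      ∀ O : AdaptiveSQ.Oracle.{u}, O.IsNatural →
        ¬ O.IsAccurate (1 / 2000) (fun n _ => k n) := by
  refine ⟨fun n => n ^ 3, ⟨fun _ => 0, tendsto_const_nhds, Eventually.of_forall fun n => ?_⟩,
    fun O hO => hO.not_isAccurate_cube⟩
  rw [add_zero]
  norm_cast
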